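/- **Setting.** Let $X$ be a nonempty compact Hausdorff space. Let $\mathcal L_{\mathsf H}$ be an arbitrary first-order language (the language of the home sort $\mathsf H$), and let $\mathcal L$ be the two-sorted first-order language, with equality for both sorts $\mathsf H,\mathsf S$, whose symbols are those of $\mathcal L_{\mathsf H}$ on the sort $\mathsf H$; on the space sort $\mathsf S$, an $n$-ary predicate for each closed $C\subseteq X^n$ ($n\ge 1$) and an $n$-ary function symbol for each continuous $f\colon X^n\to X$ ($n\ge 0$); and an arbitrary set of function symbols of sorts $\mathsf H^n\to\mathsf S$ ($n\ge 1$). A *standard structure* is an $\mathcal L$-structure $\langle M,X\rangle$ in which the sort $\mathsf S$ is $X$ with the obvious interpretation of its symbols; it is denoted by $M$. For $A\subseteq M$, $\mathcal L(A)$-formulas are $\mathcal L$-formulas with names for the elements of $A$. Let $\mathcal F$ be the least set of formulas that contains all $\mathcal L_{\mathsf H}$-formulas and all formulas $t\in C$, where $C\subseteq X^n$ is closed ($n\ge1$) and $t$ is an $n$-tuple of terms of sort $\mathsf S$, and that is closed under $\wedge$, $\vee$ and the quantifiers $\forall,\exists$ of both sorts. Let $\mathcal H\subseteq\mathcal F$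 be the set of those formulas without quantifiers of sort $\mathsf S$. Define $\mathcal F(A)$ and $\mathcal H(A)$ in the same way from $\mathcal L(A)$. An *approximation* of $\varphi\in\mathcal F(A)$ is a formula $\varphi'$, written $\varphi'>\varphi$, obtained by replacing each atomic formula $t\in C$ occurring in $\varphi$ by $t\in C'$ for some closed neighbourhood $C'$ of $C$ (and leaving the $\mathcal L_{\mathsf H}(A)$-formulas unchanged). For a set $p\subseteq\mathcal F(A)$ put $p'=\{\varphi' : \varphi'>\varphi\text{ for some }\varphi\in p\}$. Let $\mathcal U$ (the monster model) be an infinite $\mathcal F$-saturated standard structure: for every $B\subseteq\mathcal U$ with $|B|<|\mathcal U|$, every set of formulas $p(x;\eta)\subseteq\mathcal F(B)$, where $x$ and $\eta$ are finite tuples of variables of sort $\mathsf H$ and $\mathsf S$ respectively, that is finitely realized in $\mathcal U$ is realized in $\mathcal U$. Let $A\subseteq\mathcal U$ with $|A|<|\mathcal U|$, and let $x$ be a finite tuple of variables of sort $\mathsf H$. Let $S_{\mathcal H,x}(A)$ be the set of all $$\mathcal H\text{-tp}(a/A)=\{\varphi(x)\in\mathcal H(A) : \mathcal U\models\varphi(a)\},\qquad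 a\in\mathcal U^{|x|}.$$ For a set $p(x)$ of $\mathcal L(A)$-formulas and an $\mathcal L(A)$-formula $\varphi(x)$, write $p(x)\to\varphi(x)$ if every $b\in\mathcal U^{|x|}$ that satisfies all formulas of $p(x)$ in $\mathcal U$ satisfies $\varphi(x)$ in $\mathcal U$. **Statement.** Let $p(x)\in S_{\mathcal H,x}(A)$. Then for every $\mathcal L(A)$-formula $\varphi(x)$ with free variables in $x$, either $p(x)\to\varphi(x)$ or $p(x)\to\neg\varphi(x)$. Furthermore, for every such $\varphi(x)$, either $p'(x)\to\varphi(x)$ or $p'(x)\to\neg\varphi(x)$. -/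

import Mathlib

open Cardinal TopologicalSpace

universe u v w x y z

namespace TwoSorted

/-- The data of a two-sorted language `L` over a space `X`: a first-order language `home` for the
home sort `H`, and for each `n` a set of function symbols of sort `H ^ (n + 1) → S`. The symbols of
the space sort `S` are determined by `X`: closed subsets of `X ^ n` with `n ≥ 1` as predicates and
continuous functions `X ^ n → X` with `n ≥ 0` as functions. -/
structure Lang where
  home : FirstOrder.Language.{u, v}
  fn : ℕ → Type w

/-- A standard structure `⟨M, X⟩`: a structure for the home sort, and an interpretation of the
function symbols of sort `H ^ (n + 1) → S`. The sort `S` is always interpreted as `X` itself. -/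
structure StandardStructure (L : Lang.{u, v, w}) (X : Type x) where
  carrier : Type y
  homeStr : L.home.Structure carrier
  fnInterp : ∀ {n : ℕ}, L.fn n → (Fin (n + 1) → carrier) → X

attribute [instance] StandardStructure.homeStr

/-- Terms of sort `H` with names for the elements of `P` and variables `x₀, …, x_{h-1}`. They
contain symbols of the home language only. A name for `p : P` is the atomic term
`FirstOrder.Language.Term.var (Sum.inl p)`. -/
abbrev HTerm (L : Lang.{u, v, w}) (P : Type z) (h : ℕ) :=
  L.home.Term (P ⊕ Fin h)

/-- Terms of sort `S` with names for the elements of `P`, variables `x₀, …, x_{h-1}` of sort `H`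
and variables `η₀, …, η_{s-1}` of sort `S`. -/
inductive STerm (L : Lang.{u, v, w}) (X : Type x) [TopologicalSpace X] (P : Type z) (h s : ℕ) :
    Type (max u w x z) where
  | var : Fin s → STerm L X P h s
  | fn {n : ℕ} (f : L.fn n) (ts : Fin (n + 1) → HTerm L P h) : STerm L X P h s
  | cont {n : ℕ} (f : C(Fin n → X, X)) (ts : Fin n → STerm L X P h s) : STerm L X P h s

/-- All first-order two-sorted `L`-formulas with names for the elements of `P` and with free
variables among `x₀, …, x_{h-1}` of sort `H` and `η₀, …, η_{s-1}` of sort `S`. A quantifier of sort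
`H` (of sort `S`) binds the last variable of that sort. -/
inductive Fml (L : Lang.{u, v, w}) (X : Type x) [TopologicalSpace X] (P : Type z) :
    ℕ → ℕ → Type (max u v w x z) where
  | eqH {h s : ℕ} (t₁ t₂ : HTerm L P h) : Fml L X P h s
  | rel {h s n : ℕ} (R : L.home.Relations n) (ts : Fin n → HTerm L P h) : Fml L X P h s
  | eqS {h s : ℕ} (t₁ t₂ : STerm L X P h s) : Fml L X P h s
  | mem {h s n : ℕ} (ts : Fin (n + 1) → STerm L X P h s) (C : Closeds (Fin (n + 1) → X)) :
      Fml L X P h s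
  | neg {h s : ℕ} (φ : Fml L X P h s) : Fml L X P h s
  | and {h s : ℕ} (φ ψ : Fml L X P h s) : Fml L X P h s
  | or {h s : ℕ} (φ ψ : Fml L X P h s) : Fml L X P h s
  | allH {h s : ℕ} (φ : Fml L X P (h + 1) s) : Fml L X P h s
  | exH {h s : ℕ} (φ : Fml L X P (h + 1) s) : Fml L X P h s
  | allS {h s : ℕ} (φ : Fml L X P h (s + 1)) : Fml L X P h s
  | exS {h s : ℕ} (φ : Fml L X P h (s + 1)) : Fml L X P h s

section Semantics

variable {L : Lang.{u, v, w}} {X : Type x} [TopologicalSpace X] {P : Type z}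

/-- The value of a term of sort `S` in `⟨M, X⟩`, where `ν` interprets the names. -/
def STerm.realize (M : StandardStructure.{u, v, w, x, y} L X) (ν : P → M.carrier) {h s : ℕ}
    (a : Fin h → M.carrier) (α : Fin s → X) : STerm L X P h s → X
  | .var i => α i
  | .fn f ts => M.fnInterp f fun i => (ts i).realize (Sum.elim ν a)
  | .cont f ts => f fun i => (ts i).realize M ν a α

/-- Truth of a formula in `⟨M, X⟩`, where `ν` interprets the names. -/
def Fml.Realize (M : StandardStructure.{u, v, w, x, y} L X) (ν : P → M.carrier) :
    ∀ {h s : ℕ}, Fml L X P h s → (Fin h → M.carrier) → (Fin s → X) → Prop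
  | _, _, .eqH t₁ t₂, a, _ => t₁.realize (Sum.elim ν a) = t₂.realize (Sum.elim ν a)
  | _, _, .rel R ts, a, _ => FirstOrder.Language.Structure.RelMap R fun i => (ts i).realize (Sum.elim ν a)
  | _, _, .eqS t₁ t₂, a, α => t₁.realize M ν a α = t₂.realize M ν a α
  | _, _, .mem ts C, a, α => (fun i => (ts i).realize M ν a α) ∈ C
  | _, _, .neg φ, a, α => ¬ φ.Realize M ν a α
  | _, _, .and φ ψ, a, α => φ.Realize M ν a α ∧ ψ.Realize M ν a α
  | _, _, .or φ ψ, a, α => φ.Realize M ν a α ∨ ψ.Realize M ν a α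
  | _, _, .allH φ, a, α => ∀ b : M.carrier, φ.Realize M ν (Fin.snoc a b) α
  | _, _, .exH φ, a, α => ∃ b : M.carrier, φ.Realize M ν (Fin.snoc a b) α
  | _, _, .allS φ, a, α => ∀ β : X, φ.Realize M ν a (Fin.snoc α β)
  | _, _, .exS φ, a, α => ∃ β : X, φ.Realize M ν a (Fin.snoc α β)

/-- The formulas of the home language (no term, equality or quantifier of sort `S` occurs). -/
inductive IsHome : ∀ {h s : ℕ}, Fml L X P h s → Prop
  | eqH {h s : ℕ} (t₁ t₂ : HTerm L P h) : IsHome (Fml.eqH t₁ t₂ : Fml L X P h s)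
  | rel {h s n : ℕ} (R : L.home.Relations n) (ts : Fin n → HTerm L P h) :
      IsHome (Fml.rel R ts : Fml L X P h s)
  | neg {h s : ℕ} {φ : Fml L X P h s} : IsHome φ → IsHome φ.neg
  | and {h s : ℕ} {φ ψ : Fml L X P h s} : IsHome φ → IsHome ψ → IsHome (φ.and ψ)
  | or {h s : ℕ} {φ ψ : Fml L X P h s} : IsHome φ → IsHome ψ → IsHome (φ.or ψ)
  | allH {h s : ℕ} {φ : Fml L X P (h + 1) s} : IsHome φ → IsHome φ.allH
  | exH {h s : ℕ} {φ : Fml L X P (h + 1) s} : IsHome φ → IsHome φ.exH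

/-- The set `F`: the least set of formulas that contains the formulas of the home language and the
formulas `t ∈ C`, and is closed under `∧`, `∨` and the quantifiers of both sorts. -/
inductive IsF : ∀ {h s : ℕ}, Fml L X P h s → Prop
  | home {h s : ℕ} {φ : Fml L X P h s} : IsHome φ → IsF φ
  | mem {h s n : ℕ} (ts : Fin (n + 1) → STerm L X P h s) (C : Closeds (Fin (n + 1) → X)) :
      IsF (Fml.mem ts C)
  | and {h s : ℕ} {φ ψ : Fml L X P h s} : IsF φ → IsF ψ → IsF (φ.and ψ)
  | or {h s : ℕ} {φ ψ : Fml L X P h s} : IsF φ → IsF ψ → IsF (φ.or ψ)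
  | allH {h s : ℕ} {φ : Fml L X P (h + 1) s} : IsF φ → IsF φ.allH
  | exH {h s : ℕ} {φ : Fml L X P (h + 1) s} : IsF φ → IsF φ.exH
  | allS {h s : ℕ} {φ : Fml L X P h (s + 1)} : IsF φ → IsF φ.allS
  | exS {h s : ℕ} {φ : Fml L X P h (s + 1)} : IsF φ → IsF φ.exS

/-- The formula contains no quantifier of sort `S`. -/
def Fml.NoSQuantifier : ∀ {h s : ℕ}, Fml L X P h s → Prop
  | _, _, .eqH _ _ => True
  | _, _, .rel _ _ => True
  | _, _, .eqS _ _ => True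
  | _, _, .mem _ _ => True
  | _, _, .neg φ => φ.NoSQuantifier
  | _, _, .and φ ψ => φ.NoSQuantifier ∧ ψ.NoSQuantifier
  | _, _, .or φ ψ => φ.NoSQuantifier ∧ ψ.NoSQuantifier
  | _, _, .allH φ => φ.NoSQuantifier
  | _, _, .exH φ => φ.NoSQuantifier
  | _, _, .allS _ => False
  | _, _, .exS _ => False

/-- The set `H` of the formulas in `F` without quantifiers of sort `S`. -/
def IsH {h s : ℕ} (φ : Fml L X P h s) : Prop :=
  IsF φ ∧ φ.NoSQuantifier

/-- `Approx φ' φ` is `φ' > φ`: every atomic formula `t ∈ C` occurring in `φ` is replaced by `t ∈ C'`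
for some closed neighbourhood `C'` of `C`, and the formulas of the home language are left as they
are. -/
inductive Approx : ∀ {h s : ℕ}, Fml L X P h s → Fml L X P h s → Prop
  | home {h s : ℕ} {φ : Fml L X P h s} : IsHome φ → Approx φ φ
  | mem {h s n : ℕ} (ts : Fin (n + 1) → STerm L X P h s) {C' C : Closeds (Fin (n + 1) → X)} :
      (C : Set (Fin (n + 1) → X)) ⊆ interior (C' : Set (Fin (n + 1) → X)) →
        Approx (Fml.mem ts C') (Fml.mem ts C)
  | and {h s : ℕ} {φ' φ ψ' ψ : Fml L X P h s} :
      Approx φ' φ → Approx ψ' ψ → Approx (φ'.and ψ') (φ.and ψ)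
  | or {h s : ℕ} {φ' φ ψ' ψ : Fml L X P h s} :
      Approx φ' φ → Approx ψ' ψ → Approx (φ'.or ψ') (φ.or ψ)
  | allH {h s : ℕ} {φ' φ : Fml L X P (h + 1) s} : Approx φ' φ → Approx φ'.allH φ.allH
  | exH {h s : ℕ} {φ' φ : Fml L X P (h + 1) s} : Approx φ' φ → Approx φ'.exH φ.exH
  | allS {h s : ℕ} {φ' φ : Fml L X P h (s + 1)} : Approx φ' φ → Approx φ'.allS φ.allS
  | exS {h s : ℕ} {φ' φ : Fml L X P h (s + 1)} : Approx φ' φ → Approx φ'.exS φ.exS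

/-- The set `p'` of the approximations of the formulas in `p`. -/
def approximation {h s : ℕ} (p : Set (Fml L X P h s)) : Set (Fml L X P h s) :=
  {φ' | ∃ φ ∈ p, Approx φ' φ}

end Semantics

namespace StandardStructure

variable {L : Lang.{u, v, w}} {X : Type x} [TopologicalSpace X]
  (M : StandardStructure.{u, v, w, x, y} L X)

/-- `L(A)`-formulas, where `A` is a set of elements of `M`. -/
abbrev FmlOver (A : Set M.carrier) (h s : ℕ) :=
  Fml L X A h s

/-- Truth in `M` of an `L(A)`-formula at `(a ; α)`: each name is interpreted as the element of `A`
that it names. -/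
def Sat {A : Set M.carrier} {h s : ℕ} (φ : M.FmlOver A h s) (a : Fin h → M.carrier)
    (α : Fin s → X) : Prop :=
  φ.Realize M (fun c : A => (c : M.carrier)) a α

/-- `M` realizes all types `p(x ; η) ⊆ F(A)` that are finitely realized in `M`, for all sets `A` of
fewer than `κ` parameters. -/
def IsFSaturatedFor (κ : Cardinal.{y}) : Prop :=
  ∀ (A : Set M.carrier), #A < κ → ∀ (h s : ℕ) (p : Set (M.FmlOver A h s)),
    (∀ φ ∈ p, IsF φ) →
    (∀ q ⊆ p, q.Finite → ∃ (a : Fin h → M.carrier) (α : Fin s → X), ∀ φ ∈ q, M.Sat φ a α) →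
    ∃ (a : Fin h → M.carrier) (α : Fin s → X), ∀ φ ∈ p, M.Sat φ a α

/-- `M` is `F`-saturated: it is `κ`-`F`-saturated for `κ` the cardinality of `M`. -/
def IsFSaturated : Prop :=
  M.IsFSaturatedFor #M.carrier

/-- The type `H-tp(a / A)`. -/
def hType (A : Set M.carrier) {n : ℕ} (a : Fin n → M.carrier) : Set (M.FmlOver A n 0) :=
  {φ | IsH φ ∧ M.Sat φ a Fin.elim0}

/-- The set `S_{H,n}(A)` of the complete `H`-types over `A` in `n` variables of sort `H`. -/
def hTypes (A : Set M.carrier) (n : ℕ) : Set (Set (M.FmlOver A n 0)) :=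
  {p | ∃ a : Fin n → M.carrier, p = M.hType A a}

/-- `p(x) → φ(x)`: every realization of `p` in `M` satisfies `φ`. -/
def Implies {A : Set M.carrier} {n : ℕ} (p : Set (M.FmlOver A n 0)) (φ : M.FmlOver A n 0) : Prop :=
  ∀ a : Fin n → M.carrier, (∀ ψ ∈ p, M.Sat ψ a Fin.elim0) → M.Sat φ a Fin.elim0

/-- `p` is complete for the formulas in `L_x(A)`. -/
def IsLComplete {A : Set M.carrier} {n : ℕ} (p : Set (M.FmlOver A n 0)) : Prop :=
  ∀ φ : M.FmlOver A n 0, M.Implies p φ ∨ M.Implies p φ.neg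

end StandardStructure

end TwoSorted

/-! Two tuples with the same `H`-type over `A` satisfy the same `L(A)`-formulas (`sat_iff`), by
back-and-forth over the home sort. The space sort is inert: it is the same `X` on both sides, and
terms of sort `S` take equal values because singletons are closed. The obstacle is that `H` is not
closed under negation. Two facts replace negation: a formula and an approximation of it are
separated by a formula of `H` (`exists_weak_neg`), and by saturation a formula of `H` holds once all
its approximations hold (`sat_of_approx`). Hence an inclusion of `H`-types is an equality, which
gives the back-and-forth step and shows that all realizations of `p` have the same type. By
`sat_of_approx` again, realizations of `p'` realize `p`. -/

namespace TwoSorted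

/-! ### Change of parameters. -/

section Names

variable {L : Lang.{u, v, w}} {X : Type x} [TopologicalSpace X] {P : Type z} {Q : Type*}

/-- Replace each name `p` by the name `g p`. -/
def STerm.mapNames (g : P → Q) {h s : ℕ} : STerm L X P h s → STerm L X Q h s
  | .var i => .var i
  | .fn f ts => .fn f fun i => (ts i).relabel (Sum.map g id)
  | .cont f ts => .cont f fun i => (ts i).mapNames g

/-- Replace each name `p` by the name `g p`. -/
def Fml.mapNames (g : P → Q) : ∀ {h s : ℕ}, Fml L X P h s → Fml L X Q h s
  | _, _, .eqH t₁ t₂ => .eqH (t₁.relabel (Sum.map g id)) (t₂.relabel (Sum.map g id))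
  | _, _, .rel R ts => .rel R fun i => (ts i).relabel (Sum.map g id)
  | _, _, .eqS t₁ t₂ => .eqS (t₁.mapNames g) (t₂.mapNames g)
  | _, _, .mem ts C => .mem (fun i => (ts i).mapNames g) C
  | _, _, .neg φ => .neg (φ.mapNames g)
  | _, _, .and φ ψ => .and (φ.mapNames g) (ψ.mapNames g)
  | _, _, .or φ ψ => .or (φ.mapNames g) (ψ.mapNames g)
  | _, _, .allH φ => .allH (φ.mapNames g)
  | _, _, .exH φ => .exH (φ.mapNames g)
  | _, _, .allS φ => .allS (φ.mapNames g)
  | _, _, .exS φ => .exS (φ.mapNames g)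

variable (M : StandardStructure.{u, v, w, x, y} L X) (g : P → Q) (ν : Q → M.carrier)

theorem STerm.realize_mapNames {h s : ℕ} (a : Fin h → M.carrier) (α : Fin s → X)
    (t : STerm L X P h s) : (t.mapNames g).realize M ν a α = t.realize M (ν ∘ g) a α := by
  induction t with
  | var i => rfl
  | fn f ts =>
    simp only [STerm.mapNames, STerm.realize, FirstOrder.Language.Term.realize_relabel,
      Sum.elim_comp_map, Function.comp_id]
  | cont f ts ih => simp only [STerm.mapNames, STerm.realize, ih]

theorem Fml.realize_mapNames {h s : ℕ} (φ : Fml L X P h s) (a : Fin h → M.carrier)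
    (α : Fin s → X) : (φ.mapNames g).Realize M ν a α ↔ φ.Realize M (ν ∘ g) a α := by
  induction φ with
  | eqH | rel =>
    simp only [Fml.mapNames, Fml.Realize, FirstOrder.Language.Term.realize_relabel,
      Sum.elim_comp_map, Function.comp_id]
  | eqS | mem => simp only [Fml.mapNames, Fml.Realize, STerm.realize_mapNames]
  | neg _ ih => simp only [Fml.mapNames, Fml.Realize, ih]
  | and _ _ ih₁ ih₂ | or _ _ ih₁ ih₂ => simp only [Fml.mapNames, Fml.Realize, ih₁, ih₂]
  | allH _ ih | exH _ ih | allS _ ih | exS _ ih => simp only [Fml.mapNames, Fml.Realize, ih]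

theorem IsHome.mapNames {h s : ℕ} {φ : Fml L X P h s} (hφ : IsHome φ) :
    IsHome (φ.mapNames g) := by
  induction hφ with
  | eqH => exact .eqH _ _
  | rel => exact .rel _ _
  | neg _ ih => exact .neg ih
  | and _ _ ih₁ ih₂ => exact .and ih₁ ih₂
  | or _ _ ih₁ ih₂ => exact .or ih₁ ih₂
  | allH _ ih => exact .allH ih
  | exH _ ih => exact .exH ih

theorem IsF.mapNames {h s : ℕ} {φ : Fml L X P h s} (hφ : IsF φ) : IsF (φ.mapNames g) := by
  induction hφ with
  | home hφ => exact .home (hφ.mapNames g)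
  | mem => exact .mem _ _
  | and _ _ ih₁ ih₂ => exact .and ih₁ ih₂
  | or _ _ ih₁ ih₂ => exact .or ih₁ ih₂
  | allH _ ih => exact .allH ih
  | exH _ ih => exact .exH ih
  | allS _ ih => exact .allS ih
  | exS _ ih => exact .exS ih

end Names

/-! ### Approximations: directedness and weak negation. -/

section Approximation

variable {L : Lang.{u, v, w}} {X : Type x} [TopologicalSpace X] {P : Type z}

theorem IsHome.noSQuantifier {h s : ℕ} {φ : Fml L X P h s} (hφ : IsHome φ) :
    φ.NoSQuantifier := by
  induction hφ with
  | eqH | rel => trivial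
  | neg _ ih | allH _ ih | exH _ ih => exact ih
  | and _ _ ih₁ ih₂ | or _ _ ih₁ ih₂ => exact ⟨ih₁, ih₂⟩

theorem IsHome.isH {h s : ℕ} {φ : Fml L X P h s} (hφ : IsHome φ) : IsH φ :=
  ⟨.home hφ, hφ.noSQuantifier⟩

theorem isH_mem {h s n : ℕ} (ts : Fin (n + 1) → STerm L X P h s)
    (C : Closeds (Fin (n + 1) → X)) : IsH (Fml.mem ts C) :=
  ⟨.mem ts C, trivial⟩

theorem IsH.and {h s : ℕ} {φ ψ : Fml L X P h s} (hφ : IsH φ) (hψ : IsH ψ) : IsH (φ.and ψ) :=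
  ⟨.and hφ.1 hψ.1, hφ.2, hψ.2⟩

theorem IsH.or {h s : ℕ} {φ ψ : Fml L X P h s} (hφ : IsH φ) (hψ : IsH ψ) : IsH (φ.or ψ) :=
  ⟨.or hφ.1 hψ.1, hφ.2, hψ.2⟩

theorem IsH.allH {h s : ℕ} {φ : Fml L X P (h + 1) s} (hφ : IsH φ) : IsH φ.allH :=
  ⟨.allH hφ.1, hφ.2⟩

theorem IsH.exH {h s : ℕ} {φ : Fml L X P (h + 1) s} (hφ : IsH φ) : IsH φ.exH :=
  ⟨.exH hφ.1, hφ.2⟩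

/-- Finitely many formulas in `H` have a conjunction in `H`. -/
theorem exists_isH_conj (M : StandardStructure.{u, v, w, x, y} L X) (ν : P → M.carrier)
    {h s : ℕ} {q : Set (Fml L X P (h + 1) s)} (hq : q.Finite) (hH : ∀ φ ∈ q, IsH φ) :
    ∃ χ : Fml L X P (h + 1) s, IsH χ ∧
      ∀ a α, χ.Realize M ν a α ↔ ∀ φ ∈ q, φ.Realize M ν a α := by
  induction q, hq using Set.Finite.induction_on with
  | empty =>
    -- The equation `x₀ = x₀` serves as truth; the arity `h + 1` guarantees the variable.
    let t : HTerm L P (h + 1) := .var (.inr 0)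
    exact ⟨.eqH t t, (IsHome.eqH t t).isH, fun a α => by simp [Fml.Realize]⟩
  | @insert φ q _ _ ih =>
    obtain ⟨χ, hχ, hr⟩ := ih fun ψ hψ => hH ψ (Set.mem_insert_of_mem _ hψ)
    exact ⟨φ.and χ, (hH φ (Set.mem_insert _ _)).and hχ, fun a α => by simp [Fml.Realize, hr]⟩

/-- A compound home formula is approximated through `home` or through its connective; this
reconciles the two in `exists_le`. -/
theorem Approx.eq_of_isHome {h s : ℕ} {φ' φ : Fml L X P h s} (ha : Approx φ' φ)
    (hφ : IsHome φ) : φ' = φ := by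
  induction ha with
  | home => rfl
  | mem => cases hφ
  | and _ _ ih₁ ih₂ => cases hφ with | and h₁ h₂ => rw [ih₁ h₁, ih₂ h₂]
  | or _ _ ih₁ ih₂ => cases hφ with | or h₁ h₂ => rw [ih₁ h₁, ih₂ h₂]
  | allH _ ih => cases hφ with | allH h => rw [ih h]
  | exH _ ih => cases hφ with | exH h => rw [ih h]
  | allS | exS => cases hφ

/-- The whole space is a closed neighbourhood of every closed set. -/
theorem IsF.exists_approx {h s : ℕ} {φ : Fml L X P h s} (hφ : IsF φ) :
    ∃ φ', Approx φ' φ := by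
  induction hφ with
  | home hφ => exact ⟨_, .home hφ⟩
  | mem ts C => exact ⟨_, .mem ts (C' := ⊤) (by simp)⟩
  | and _ _ ih₁ ih₂ => exact ⟨_, .and ih₁.choose_spec ih₂.choose_spec⟩
  | or _ _ ih₁ ih₂ => exact ⟨_, .or ih₁.choose_spec ih₂.choose_spec⟩
  | allH _ ih => exact ⟨_, .allH ih.choose_spec⟩
  | exH _ ih => exact ⟨_, .exH ih.choose_spec⟩
  | allS _ ih => exact ⟨_, .allS ih.choose_spec⟩
  | exS _ ih => exact ⟨_, .exS ih.choose_spec⟩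

theorem Approx.isF {h s : ℕ} {φ' φ : Fml L X P h s} (ha : Approx φ' φ) : IsF φ' := by
  induction ha with
  | home hφ => exact .home hφ
  | mem => exact .mem _ _
  | and _ _ ih₁ ih₂ => exact .and ih₁ ih₂
  | or _ _ ih₁ ih₂ => exact .or ih₁ ih₂
  | allH _ ih => exact .allH ih
  | exH _ ih => exact .exH ih
  | allS _ ih => exact .allS ih
  | exS _ ih => exact .exS ih

variable (M : StandardStructure.{u, v, w, x, y} L X) (ν : P → M.carrier)

/-- The approximations of a formula are directed downwards. -/
theorem Approx.exists_le {h s : ℕ} {φ₁ φ₂ φ : Fml L X P h s} (h₁ : Approx φ₁ φ)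
    (h₂ : Approx φ₂ φ) : ∃ φ₃, Approx φ₃ φ ∧ ∀ a α, φ₃.Realize M ν a α →
      φ₁.Realize M ν a α ∧ φ₂.Realize M ν a α := by
  induction h₁ with
  | home hφ => exact ⟨φ₂, h₂, fun a α h => ⟨h₂.eq_of_isHome hφ ▸ h, h⟩⟩
  | mem ts hC =>
    cases h₂ with
    | home hφ => cases hφ
    | @mem _ _ _ _ C₂ _ hC₂ =>
      rename_i C₁ _
      refine ⟨_, .mem ts (C' := C₁ ⊓ C₂) ?_, fun a α h => h⟩
      rw [Closeds.coe_inf, interior_inter]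
      exact Set.subset_inter hC hC₂
  | and k₁ k₂ ih₁ ih₂ =>
    cases h₂ with
    | home hφ =>
      cases hφ with
      | and e₁ e₂ =>
        exact ⟨_, .and k₁ k₂, fun a α h => ⟨h, k₁.eq_of_isHome e₁ ▸ k₂.eq_of_isHome e₂ ▸ h⟩⟩
    | and l₁ l₂ =>
      obtain ⟨ψ₁, c₁, d₁⟩ := ih₁ l₁
      obtain ⟨ψ₂, c₂, d₂⟩ := ih₂ l₂
      exact ⟨_, .and c₁ c₂, fun a α h =>
        ⟨⟨(d₁ _ _ h.1).1, (d₂ _ _ h.2).1⟩, (d₁ _ _ h.1).2, (d₂ _ _ h.2).2⟩⟩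
  | or k₁ k₂ ih₁ ih₂ =>
    cases h₂ with
    | home hφ =>
      cases hφ with
      | or e₁ e₂ =>
        exact ⟨_, .or k₁ k₂, fun a α h => ⟨h, k₁.eq_of_isHome e₁ ▸ k₂.eq_of_isHome e₂ ▸ h⟩⟩
    | or l₁ l₂ =>
      obtain ⟨ψ₁, c₁, d₁⟩ := ih₁ l₁
      obtain ⟨ψ₂, c₂, d₂⟩ := ih₂ l₂
      exact ⟨_, .or c₁ c₂, fun a α h =>
        ⟨h.imp (fun k => (d₁ _ _ k).1) fun k => (d₂ _ _ k).1,
          h.imp (fun k => (d₁ _ _ k).2) fun k => (d₂ _ _ k).2⟩⟩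
  | allH k ih =>
    cases h₂ with
    | home hφ =>
      cases hφ with
      | allH e => exact ⟨_, .allH k, fun a α h => ⟨h, k.eq_of_isHome e ▸ h⟩⟩
    | allH l =>
      obtain ⟨ψ, c, d⟩ := ih l
      exact ⟨_, .allH c, fun a α h => ⟨fun b => (d _ _ (h b)).1, fun b => (d _ _ (h b)).2⟩⟩
  | exH k ih =>
    cases h₂ with
    | home hφ =>
      cases hφ with
      | exH e => exact ⟨_, .exH k, fun a α h => ⟨h, k.eq_of_isHome e ▸ h⟩⟩
    | exH l =>
      obtain ⟨ψ, c, d⟩ := ih l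
      exact ⟨_, .exH c, fun a α ⟨b, h⟩ => ⟨⟨b, (d _ _ h).1⟩, b, (d _ _ h).2⟩⟩
  | allS k ih =>
    cases h₂ with
    | home hφ => cases hφ
    | allS l =>
      obtain ⟨ψ, c, d⟩ := ih l
      exact ⟨_, .allS c, fun a α h => ⟨fun b => (d _ _ (h b)).1, fun b => (d _ _ (h b)).2⟩⟩
  | exS k ih =>
    cases h₂ with
    | home hφ => cases hφ
    | exS l =>
      obtain ⟨ψ, c, d⟩ := ih l
      exact ⟨_, .exS c, fun a α ⟨b, h⟩ => ⟨⟨b, (d _ _ h).1⟩, b, (d _ _ h).2⟩⟩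

/-- Finitely many approximations of a formula have a common strengthening. -/
theorem exists_approx_le_of_finite {h s : ℕ} {φ : Fml L X P h s} (hφ : IsF φ)
    {q : Set (Fml L X P h s)} (hq : q.Finite) (ha : ∀ ψ ∈ q, Approx ψ φ) :
    ∃ χ, Approx χ φ ∧ ∀ a α, χ.Realize M ν a α → ∀ ψ ∈ q, ψ.Realize M ν a α := by
  induction q, hq using Set.Finite.induction_on with
  | empty => exact hφ.exists_approx.imp fun _ h => ⟨h, by simp⟩
  | @insert ψ q _ _ ih =>
    obtain ⟨χ, hχ, hr⟩ := ih fun ψ hψ => ha ψ (Set.mem_insert_of_mem _ hψ)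
    obtain ⟨θ, hθ, hr'⟩ := (ha ψ (Set.mem_insert _ _)).exists_le M ν hχ
    refine ⟨θ, hθ, fun a α h => ?_⟩
    rintro _ (rfl | hψ)
    · exact (hr' a α h).1
    · exact hr a α (hr' a α h).2 _ hψ

/-- A formula in `H` and an approximation of it are separated by the negation of a formula
in `H`. -/
theorem Approx.exists_weak_neg {h s : ℕ} {φ' φ : Fml L X P h s} (ha : Approx φ' φ)
    (hφ : φ.NoSQuantifier) : ∃ ψ : Fml L X P h s, IsH ψ ∧ ∀ a α,
      (¬ φ'.Realize M ν a α → ψ.Realize M ν a α) ∧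
      (ψ.Realize M ν a α → ¬ φ.Realize M ν a α) := by
  induction ha with
  | home h => exact ⟨_, h.neg.isH, fun a α => ⟨id, id⟩⟩
  | @mem _ _ n ts C' C hC =>
    -- The complement of the interior of `C'` is closed, contains the complement of `C'` and misses
    -- `C`.
    refine ⟨.mem ts ⟨(interior (C' : Set (Fin (n + 1) → X)))ᶜ, isOpen_interior.isClosed_compl⟩, isH_mem _ _,
      fun a α => ⟨fun h k => h ?_, fun h k => h (hC k)⟩⟩
    exact interior_subset (s := (C' : Set (Fin (n + 1) → X))) k
  | and _ _ ih₁ ih₂ =>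
    obtain ⟨ψ₁, e₁, d₁⟩ := ih₁ hφ.1
    obtain ⟨ψ₂, e₂, d₂⟩ := ih₂ hφ.2
    refine ⟨_, e₁.or e₂, fun a α => ⟨fun h => ?_, ?_⟩⟩
    · exact (not_and_or.1 h).imp (d₁ a α).1 (d₂ a α).1
    · rintro (h | h) k
      exacts [(d₁ a α).2 h k.1, (d₂ a α).2 h k.2]
  | or _ _ ih₁ ih₂ =>
    obtain ⟨ψ₁, e₁, d₁⟩ := ih₁ hφ.1
    obtain ⟨ψ₂, e₂, d₂⟩ := ih₂ hφ.2
    refine ⟨_, e₁.and e₂, fun a α => ⟨fun h => ?_, fun h => ?_⟩⟩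
    · exact (not_or.1 h).imp (d₁ a α).1 (d₂ a α).1
    · exact not_or.2 (h.imp (d₁ a α).2 (d₂ a α).2)
  | allH _ ih =>
    obtain ⟨ψ, e, d⟩ := ih hφ
    exact ⟨_, e.exH, fun a α => ⟨fun h => (not_forall.1 h).imp fun b => (d _ _).1,
      fun ⟨b, h⟩ k => (d _ _).2 h (k b)⟩⟩
  | exH _ ih =>
    obtain ⟨ψ, e, d⟩ := ih hφ
    exact ⟨_, e.allH, fun a α => ⟨fun h b => (d _ _).1 (not_exists.1 h b),
      fun h ⟨b, k⟩ => (d _ _).2 (h b) k⟩⟩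
  | allS | exS => exact hφ.elim

end Approximation

/-! ### Consequences of saturation. -/

namespace StandardStructure

variable {L : Lang.{u, v, w}} {X : Type x} [TopologicalSpace X]
  {M : StandardStructure.{u, v, w, x, y} L X}

theorem mk_union_range_lt {κ : Type y} [Infinite κ] {A : Set κ} (hA : #A < #κ) {n : ℕ}
    (a : Fin n → κ) : #(A ∪ Set.range a : Set κ) < #κ :=
  (mk_union_le _ _).trans_lt <| add_lt_of_lt (aleph0_le_mk κ) hA <|
    (Set.finite_range a).lt_aleph0.trans_le (aleph0_le_mk κ)

/-- In a saturated structure, a type over `A` in one more variable over a tuple is realized if it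
is finitely realized. -/
theorem IsFSaturated.exists_snoc [T1Space X] [Infinite M.carrier] (hM : M.IsFSaturated)
    {A : Set M.carrier} (hA : #A < #M.carrier) {h s : ℕ} (a : Fin h → M.carrier)
    (α : Fin s → X) (p : Set (M.FmlOver A (h + 1) s)) (hp : ∀ φ ∈ p, IsF φ)
    (hfin : ∀ q ⊆ p, q.Finite → ∃ c : M.carrier, ∀ φ ∈ q, M.Sat φ (Fin.snoc a c) α) :
    ∃ c : M.carrier, ∀ φ ∈ p, M.Sat φ (Fin.snoc a c) α := by
  let B : Set M.carrier := A ∪ Set.range a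
  let g : A → B := fun c => ⟨c, Or.inl c.2⟩
  have hg (φ : M.FmlOver A (h + 1) s) (b : Fin (h + 1) → M.carrier) (β : Fin s → X) :
      M.Sat (A := B) (φ.mapNames g) b β ↔ M.Sat φ b β := φ.realize_mapNames M g _ b β
  -- Saturation realizes all variables at once, so the given tuples are pinned inside the type: `a`
  -- by equations with new names, `α`, which has no names, by closed singletons of `X ^ 1`.
  let eH : Fin h → M.FmlOver B (h + 1) s := fun i =>
    .eqH (.var (.inr i.castSucc)) (.var (.inl ⟨a i, Or.inr ⟨i, rfl⟩⟩))
  let eS : Fin s → M.FmlOver B (h + 1) s := fun j =>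
    .mem (n := 0) (fun _ => .var j) ⟨{fun _ => α j}, isClosed_singleton⟩
  obtain ⟨b, β, hb⟩ := hM B (mk_union_range_lt hA a) (h + 1) s
    (Fml.mapNames g '' p ∪ (Set.range eH ∪ Set.range eS)) (by
      rintro _ (⟨φ, hφ, rfl⟩ | ⟨i, rfl⟩ | ⟨j, rfl⟩)
      exacts [(hp φ hφ).mapNames g, .home (.eqH _ _), .mem _ _]) (by
      intro q hq hqf
      -- Only the part of `q` that comes from `p` needs a witness; the pinning formulas hold at `a`,
      -- `α` anyway.
      obtain ⟨r, hr, hrf, hrq⟩ := Set.exists_subset_image_finite_and (f := Fml.mapNames g)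
        (s := p) (p := fun t => t = q ∩ Fml.mapNames g '' p) |>.1
        ⟨_, Set.inter_subset_right, hqf.subset Set.inter_subset_left, rfl⟩
      obtain ⟨c, hc⟩ := hfin r hr hrf
      refine ⟨Fin.snoc a c, α, fun φ hφ => ?_⟩
      obtain hφ' | ⟨i, rfl⟩ | ⟨j, rfl⟩ := hq hφ
      · obtain ⟨ψ, hψ, rfl⟩ : φ ∈ Fml.mapNames g '' r := hrq ▸ ⟨hφ, hφ'⟩
        exact (hg ψ _ _).2 (hc ψ hψ)
      · simp [eH, Sat, Fml.Realize]
      · rfl)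
  have hbα : β = α := funext fun j =>
    congrFun (hb _ (Or.inr (Or.inr ⟨j, rfl⟩)) : (fun _ : Fin 1 => β j) = fun _ => α j) 0
  have hba : b = Fin.snoc a (b (Fin.last h)) := by
    rw [← Fin.snoc_init_self b]
    congr 1
    · exact funext fun i => hb _ (Or.inr (Or.inl ⟨i, rfl⟩))
    · simp
  refine ⟨b (Fin.last h), fun φ hφ => ?_⟩
  rw [← hba, ← hbα]
  exact (hg φ b β).1 (hb _ (Or.inl ⟨φ, hφ, rfl⟩))

/-- In a saturated structure, a formula in `H` is equivalent to the set of its approximations. -/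
theorem IsFSaturated.sat_of_approx [CompactSpace X] [T2Space X] [Infinite M.carrier]
    (hM : M.IsFSaturated) {A : Set M.carrier} (hA : #A < #M.carrier) {h s : ℕ}
    {φ : M.FmlOver A h s} (hF : IsF φ) (hφ : φ.NoSQuantifier) (a : Fin h → M.carrier)
    (α : Fin s → X) (hall : ∀ φ', Approx φ' φ → M.Sat φ' a α) : M.Sat φ a α := by
  induction hF with
  | home hhome => exact hall _ (.home hhome)
  | mem ts C =>
    by_contra hC
    -- A power of `X` is compact Hausdorff, hence normal: some closed neighbourhood of `C` misses
    -- the value of the term.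
    obtain ⟨V, hV, hCV, hVx⟩ := normal_exists_closure_subset C.isClosed
      (isOpen_compl_singleton (x := fun i => (ts i).realize M _ a α))
      (Set.subset_compl_singleton_iff.2 hC)
    exact hVx (hall _ (.mem ts (C' := ⟨closure V, isClosed_closure⟩)
      (hCV.trans (interior_maximal subset_closure hV)))) rfl
  | and h₁ h₂ ih₁ ih₂ =>
    obtain ⟨φ₁, k₁⟩ := h₁.exists_approx
    obtain ⟨φ₂, k₂⟩ := h₂.exists_approx
    exact ⟨ih₁ hφ.1 a α fun φ' h => (show M.Sat φ' a α ∧ _ from hall _ (h.and k₂)).1,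
      ih₂ hφ.2 a α fun φ' h => (show _ ∧ M.Sat φ' a α from hall _ (k₁.and h)).2⟩
  | or h₁ h₂ ih₁ ih₂ =>
    by_contra hn
    obtain ⟨n₁, n₂⟩ := not_or.1 hn
    obtain ⟨φ₁, k₁, l₁⟩ : ∃ φ', Approx φ' _ ∧ ¬ M.Sat φ' a α := by
      by_contra! hc
      exact n₁ (ih₁ hφ.1 a α hc)
    obtain ⟨φ₂, k₂, l₂⟩ : ∃ φ', Approx φ' _ ∧ ¬ M.Sat φ' a α := by
      by_contra! hc
      exact n₂ (ih₂ hφ.2 a α hc)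
    exact (hall _ (k₁.or k₂)).elim l₁ l₂
  | allH _ ih => exact fun b => ih hφ _ α fun _ h => hall _ h.allH b
  | exH hF ih =>
    -- A single witness is needed for all approximations of the matrix. Finitely many have a common
    -- strengthening `χ`, and `∃ χ` approximates the given formula.
    obtain ⟨c, hc⟩ := hM.exists_snoc hA a α {ψ | Approx ψ _} (fun _ h => Approx.isF h)
      fun q hq hqf => by
        obtain ⟨χ, hχ, hr⟩ := exists_approx_le_of_finite M _ hF hqf hq
        exact (hall _ hχ.exH).imp fun c hc => hr _ _ hc
    exact ⟨c, ih hφ _ α hc⟩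
  | allS | exS => exact hφ.elim

/-- In a saturated structure, if all formulas in `H` that are true of `a` are true of `b`, then
`a` and `b` satisfy the same formulas in `H`. -/
theorem IsFSaturated.hType_eq_of_subset [CompactSpace X] [T2Space X] [Infinite M.carrier]
    (hM : M.IsFSaturated) {A : Set M.carrier} (hA : #A < #M.carrier) {n : ℕ}
    {a b : Fin n → M.carrier} (hab : M.hType A a ⊆ M.hType A b) :
    M.hType A a = M.hType A b := by
  refine hab.antisymm fun φ ⟨hH, hφ⟩ => ⟨hH, ?_⟩
  refine hM.sat_of_approx hA hH.1 hH.2 a _ fun φ' hφ' => ?_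
  -- If `φ'` fails at `a`, its weak negation holds at `a`, hence at `b`, and refutes `φ` there.
  by_contra hn
  obtain ⟨ψ, hψ, hr⟩ := hφ'.exists_weak_neg M (fun c : A => (c : M.carrier)) hH.2
  exact (hr _ _).2 (hab ⟨hψ, (hr _ _).1 hn⟩).2 hφ

/-- In a saturated structure, equality of types in `H` has the back-and-forth property. -/
theorem IsFSaturated.exists_hType_snoc_eq [CompactSpace X] [T2Space X] [Infinite M.carrier]
    (hM : M.IsFSaturated) {A : Set M.carrier} (hA : #A < #M.carrier) {n : ℕ}
    {a b : Fin n → M.carrier} (hab : M.hType A a = M.hType A b) (c : M.carrier) :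
    ∃ d : M.carrier, M.hType A (Fin.snoc a c : Fin (n + 1) → M.carrier) =
      M.hType A (Fin.snoc b d : Fin (n + 1) → M.carrier) := by
  obtain ⟨d, hd⟩ := hM.exists_snoc hA b Fin.elim0
    (M.hType A (Fin.snoc a c : Fin (n + 1) → M.carrier)) (fun φ h => h.1.1) fun q hq hqf => by
      obtain ⟨χ, hχ, hr⟩ := exists_isH_conj M (fun c : A => (c : M.carrier)) hqf
        fun φ h => (hq h).1
      -- `H` is closed under conjunction and home quantifiers, so finite satisfiability passes from
      -- `a` to `b`.
      have : χ.exH ∈ M.hType A b := hab ▸ ⟨hχ.exH, c, (hr _ _).2 fun φ h => (hq h).2⟩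
      exact this.2.imp fun d hd => (hr _ _).1 hd
  exact ⟨d, hM.hType_eq_of_subset hA fun φ h => ⟨h.1, hd φ h⟩⟩

/-! ### Transfer of formulas between tuples of the same type. -/

theorem sat_iff_of_hType_eq {A : Set M.carrier} {n : ℕ} {a b : Fin n → M.carrier}
    (hab : M.hType A a = M.hType A b) {φ : M.FmlOver A n 0} (hφ : IsH φ) :
    M.Sat φ a Fin.elim0 ↔ M.Sat φ b Fin.elim0 := by
  have := Set.ext_iff.1 hab φ
  simpa [hType, hφ] using this

theorem realize_eq_of_hType_eq [T1Space X] {A : Set M.carrier} {h s : ℕ}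
    {a b : Fin h → M.carrier} (hab : M.hType A a = M.hType A b) (α : Fin s → X)
    (t : STerm L X A h s) :
    t.realize M (fun c : A => (c : M.carrier)) a α =
      t.realize M (fun c : A => (c : M.carrier)) b α := by
  induction t with
  | var => rfl
  | fn f ts =>
    -- A term `f ts` contains no variable of sort `S`, so its membership in the closed singleton of
    -- its value at `a` is a formula of the type.
    have := (sat_iff_of_hType_eq hab (isH_mem (fun _ : Fin 1 => STerm.fn f ts)
      ⟨{fun _ => M.fnInterp f fun i => (ts i).realize (Sum.elim (fun c : A => (c : M.carrier)) a)},
        isClosed_singleton⟩)).1 rfl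
    exact (congrFun this 0).symm
  | cont f ts ih => simp only [STerm.realize, ih]

/-- In a saturated structure, tuples with the same type in `H` satisfy the same formulas. -/
theorem IsFSaturated.sat_iff [CompactSpace X] [T2Space X] [Infinite M.carrier]
    (hM : M.IsFSaturated) {A : Set M.carrier} (hA : #A < #M.carrier) {h s : ℕ}
    (φ : M.FmlOver A h s) {a b : Fin h → M.carrier} (hab : M.hType A a = M.hType A b)
    (α : Fin s → X) : M.Sat φ a α ↔ M.Sat φ b α := by
  induction φ with
  | eqH t₁ t₂ => exact sat_iff_of_hType_eq hab (IsHome.eqH t₁ t₂).isH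
  | rel R ts => exact sat_iff_of_hType_eq hab (IsHome.rel R ts).isH
  -- Equality of sort `S` is not in `F`, but it depends only on the values of the terms.
  | eqS | mem => simp only [Sat, Fml.Realize, realize_eq_of_hType_eq hab]
  | neg _ ih => exact not_congr (ih hab α)
  | and _ _ ih₁ ih₂ => exact and_congr (ih₁ hab α) (ih₂ hab α)
  | or _ _ ih₁ ih₂ => exact or_congr (ih₁ hab α) (ih₂ hab α)
  | allH _ ih =>
    refine ⟨fun H d => ?_, fun H c => ?_⟩
    · obtain ⟨c, hc⟩ := hM.exists_hType_snoc_eq hA hab.symm d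
      exact (ih hc α).2 (H c)
    · obtain ⟨d, hd⟩ := hM.exists_hType_snoc_eq hA hab c
      exact (ih hd α).2 (H d)
  | exH _ ih =>
    refine ⟨fun ⟨c, H⟩ => ?_, fun ⟨d, H⟩ => ?_⟩
    · obtain ⟨d, hd⟩ := hM.exists_hType_snoc_eq hA hab c
      exact ⟨d, (ih hd α).1 H⟩
    · obtain ⟨c, hc⟩ := hM.exists_hType_snoc_eq hA hab.symm d
      exact ⟨c, (ih hc α).1 H⟩
  -- The same point `β` of `X` serves for both tuples.
  | allS _ ih => exact forall_congr' fun β => ih hab _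
  | exS _ ih => exact exists_congr fun β => ih hab _

end StandardStructure

end TwoSorted

theorem mainTheorem5 {X : Type x} [TopologicalSpace X] [Nonempty X] [CompactSpace X] [T2Space X]
    (L : TwoSorted.Lang.{u, v, w}) (U : TwoSorted.StandardStructure.{u, v, w, x, y} L X)
    (hinf : Infinite U.carrier) (hsat : U.IsFSaturated)
    (A : Set U.carrier) (hA : Cardinal.mk A < Cardinal.mk U.carrier)
    (n : ℕ) (p : Set (U.FmlOver A n 0)) (hp : p ∈ U.hTypes A n) :
    U.IsLComplete p ∧ U.IsLComplete (TwoSorted.approximation p) := by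
  obtain ⟨a, rfl⟩ := hp
  have key (b : Fin n → U.carrier) (hb : ∀ ψ ∈ U.hType A a, U.Sat ψ b Fin.elim0)
      (φ : U.FmlOver A n 0) : U.Sat φ a Fin.elim0 ↔ U.Sat φ b Fin.elim0 :=
    hsat.sat_iff hA φ (hsat.hType_eq_of_subset hA fun ψ h => ⟨h.1, hb ψ h⟩) _
  have key' (b : Fin n → U.carrier)
      (hb : ∀ ψ ∈ TwoSorted.approximation (U.hType A a), U.Sat ψ b Fin.elim0) :
      ∀ ψ ∈ U.hType A a, U.Sat ψ b Fin.elim0 := fun ψ h =>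
    hsat.sat_of_approx hA h.1.1 h.1.2 b _ fun ψ' hψ' => hb ψ' ⟨ψ, h, hψ'⟩
  have compl : U.IsLComplete (U.hType A a) := fun φ =>
    (em (U.Sat φ a Fin.elim0)).imp (fun h b hb => (key b hb φ).1 h)
      fun h b hb k => h ((key b hb φ).2 k)
  exact ⟨compl, fun φ => (compl φ).imp (fun h b hb => h b (key' b hb))
    fun h b hb => h b (key' b hb)⟩
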